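/- All vector spaces are over $\mathbb{Q}$ and are graded by $\mathbb{Z}$ (homological grading, unbounded, no finiteness assumption). An $L_\infty$-algebra is a chain complex $(L,d)$ with graded antisymmetric operations $l_n\colon L^{\otimes n}\to L$ of degree $n-2$ ($n\ge 2$) such that for all $n\ge 2$ $$ d\, l_n-(-1)^{n} l_n\, d=\sum_{\substack{p,q\ge 2\\ p+q=n+1}}\ \sum_{\sigma\in \mathrm{Sh}(q,p-1)}\operatorname{sgn}(\sigma)(-1)^{(p-1)q}\, l_p\circ(l_q\otimes \mathrm{id}^{\otimes p-1})\circ\sigma^{-1}, $$ where in $l_n d$ the letter $d$ denotes the differential of $L^{\otimes n}$. It is minimal if $d=0$. Its Chevalley–Eilenberg complex is $\mathrm{CE}_*(L)=\bigoplus_{n\ge 0}((sL)^{\otimes n})_{\Sigma_n}$ with the coderivation differential $d+b$ whose components $(sL)^{\otimes n}\to sL$ are $sx\mapsto -s\,dx$ for $n=1$ and $sx_1\cdots sx_n\mapsto (-1)^{\sum_i (n-i)|x_i|}\,s\,l_n(x_1,\dots,x_n)$ for $n\ge 2$. An $L_\infty$-algebra $L$ is Koszul if it is equipped with a weight grading $L=\bigoplus_{w\ge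 1}L^{(w)}$ by graded subspaces such that $l_n$ is homogeneous of weight $2-n$ for all $n\ge 1$ (with $l_1=d$), and such that, with $s$ of weight $-1$, the cochain complex $$\mathrm{CE}_*(L)^{(0)}\to \mathrm{CE}_*(L)^{(1)}\to \mathrm{CE}_*(L)^{(2)}\to\cdots$$ (with differential $d+b$) is exact in all positive weights. For a graded vector space $W$, let $\mathbb{L}_\infty(W)$ be the free $L_\infty$-algebra on $W$, where $W$ is regarded as a complex with zero differential. **Proposition.** Every minimal Koszul $L_\infty$-algebra $L$ is generated in weight $1$: if $W=L^{(1)}$, then the canonical strict morphism of $L_\infty$-algebras $\mathbb{L}_\infty(W)\to L$ extending the inclusion $W\subseteq L$ is surjective. -/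

import Mathlib

universe u v w

namespace LInfty

/-- For elements `y_1, …, y_n` of degrees `b_1, …, b_n`, the Koszul sign `ε(σ; y)` with
`y_1 ⋯ y_n = ε(σ; y) y_σ(1) ⋯ y_σ(n)` in a graded commutative algebra: one factor
`(-1) ^ (b_k * b_l)` for every pair whose order is reversed. -/
def koszulSign {n : ℕ} (σ : Equiv.Perm (Fin n)) (b : Fin n → ℤ) : ℤˣ :=
  ∏ i, ∏ j, if i < j ∧ σ j < σ i then (b (σ i) * b (σ j)).negOnePow else 1

theorem koszulSign_mul {n : ℕ} (τ σ : Equiv.Perm (Fin n)) (b : Fin n → ℤ) :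
    koszulSign (τ * σ) b = koszulSign τ b * koszulSign σ (b ∘ τ) := by
  have fold : ∀ F : Fin n → Fin n → ℤˣ, (∀ i, F i i = 1) →
      ∏ i, ∏ j, F i j = ∏ i, ∏ j, if i < j then F i j * F j i else 1 := by
    intro F hF
    have h1 : ∏ i, ∏ j, F i j
        = (∏ i, ∏ j, if i < j then F i j else 1) * ∏ i, ∏ j, if j < i then F i j else 1 := by
      simp only [← Finset.prod_mul_distrib]
      refine Finset.prod_congr rfl fun i _ => Finset.prod_congr rfl fun j _ => ?_
      rcases lt_trichotomy i j with h | h | h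
      · simp [h, h.not_gt]
      · subst h; simp [hF]
      · simp [h, h.not_gt]
    rw [h1, Finset.prod_comm (f := fun i j => if j < i then F i j else 1)]
    simp only [← Finset.prod_mul_distrib]
    refine Finset.prod_congr rfl fun i _ => Finset.prod_congr rfl fun j _ => ?_
    split_ifs <;> simp
  have hτ : koszulSign τ b = ∏ i, ∏ j, if σ i < σ j ∧ τ (σ j) < τ (σ i)
      then (b (τ (σ i)) * b (τ (σ j))).negOnePow else 1 := by
    unfold koszulSign
    rw [← Equiv.prod_comp σ]
    refine Finset.prod_congr rfl fun i _ => ?_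
    rw [← Equiv.prod_comp σ]
  rw [hτ, fold _ (by simp)]
  unfold koszulSign
  simp only [← Finset.prod_mul_distrib]
  refine Finset.prod_congr rfl fun i _ => Finset.prod_congr rfl fun j _ => ?_
  by_cases hij : i < j
  swap
  · simp [hij]
  have hne : σ i ≠ σ j := fun h => hij.ne (σ.injective h)
  have hne' : τ (σ i) ≠ τ (σ j) := fun h => hne (τ.injective h)
  have hc : b (τ (σ j)) * b (τ (σ i)) = b (τ (σ i)) * b (τ (σ j)) := mul_comm _ _
  rcases lt_or_gt_of_ne hne with h | h <;> rcases lt_or_gt_of_ne hne' with h' | h' <;>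
    simp [hij, h, h', h.not_gt, h'.not_gt, hc]

section operations

variable {V : Type v} [AddCommGroup V] [Module ℚ V]
variable {N : Type w} [AddCommGroup N] [Module ℚ N]

/-- The composite `g ∘ (f ⊗ id) ∘ σ⁻¹` without its Koszul sign:
`(x_1, …, x_n) ↦ g (f (x_σ(1), …, x_σ(q)), x_σ(q+1), …, x_σ(n))`. -/
def insertOp {n : ℕ} (q : ℕ) (hq : q ≤ n)
    (g : MultilinearMap ℚ (fun _ : Fin (n - q + 1) => V) N)
    (f : MultilinearMap ℚ (fun _ : Fin q => V) V) (σ : Equiv.Perm (Fin n)) :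
    MultilinearMap ℚ (fun _ : Fin n => V) N :=
  ((g.curryLeft.compMultilinearMap f).uncurrySum).domDomCongr
    ((finSumFinEquiv.trans (finCongr (Nat.add_sub_of_le hq))).trans σ)

theorem insertOp_apply {n : ℕ} (q : ℕ) (hq : q ≤ n)
    (g : MultilinearMap ℚ (fun _ : Fin (n - q + 1) => V) N)
    (f : MultilinearMap ℚ (fun _ : Fin q => V) V) (σ : Equiv.Perm (Fin n)) (x : Fin n → V) :
    insertOp q hq g f σ x =
      g (Fin.cons (f fun i => x (σ (Fin.castLE hq i)))
        fun j : Fin (n - q) => x (σ ⟨q + j, by omega⟩)) := by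
  rfl


/-- The unary operation `l_1` as a linear map. -/
def diff (l : ∀ n : ℕ, MultilinearMap ℚ (fun _ : Fin n => V) V) : V →ₗ[ℚ] V :=
  (l 1).toLinearMap 0 0

theorem diff_apply (l : ∀ n : ℕ, MultilinearMap ℚ (fun _ : Fin n => V) V) (x : V) :
    diff l x = l 1 (fun _ => x) := by
  change l 1 (Function.update 0 0 x) = _
  congr 1
  funext i
  rw [Subsingleton.elim i 0, Function.update_self]

/-- The differential of `l_n` in the complex `Hom(V^⊗n, V)`, i.e. `d ∘ l_n - (-1)^(n-2) l_n ∘ d`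
with `d = l_1`, as a map on elements of degrees `a_1, …, a_n`; see `boundary_apply`. -/
def boundary (l : ∀ n : ℕ, MultilinearMap ℚ (fun _ : Fin n => V) V) (n : ℕ) (a : Fin n → ℤ) :
    MultilinearMap ℚ (fun _ : Fin n => V) V :=
  (diff l).compMultilinearMap (l n) -
    (n : ℤ).negOnePow • ∑ k : Fin n, (∑ j with j < k, a j).negOnePow •
      (l n).compLinearMap (Function.update (fun _ => LinearMap.id) k (diff l))

theorem boundary_apply (l : ∀ n : ℕ, MultilinearMap ℚ (fun _ : Fin n => V) V) (n : ℕ)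
    (a : Fin n → ℤ) (x : Fin n → V) :
    boundary l n a x = diff l (l n x) -
      (n : ℤ).negOnePow • ∑ k : Fin n, (∑ j with j < k, a j).negOnePow •
        l n (Function.update x k (diff l (x k))) := by
  have h : ∀ k : Fin n, (fun i => (Function.update (fun _ => LinearMap.id) k (diff l) :
      Fin n → V →ₗ[ℚ] V) i (x i)) = Function.update x k (diff l (x k)) := by
    intro k; funext i
    by_cases hi : i = k
    · subst hi; simp
    · simp [hi]
  simp only [boundary, sub_apply, LinearMap.compMultilinearMap_apply,
    smul_apply, sum_apply, MultilinearMap.compLinearMap_apply, h]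

/-- `σ` is a `(q, n - q)`-shuffle: it is increasing on the first `q` positions and on the last
`n - q` positions. -/
def IsShuffle {n : ℕ} (q : ℕ) (σ : Equiv.Perm (Fin n)) : Prop :=
  ∀ i j : Fin n, i < j → ((j : ℕ) < q ∨ q ≤ (i : ℕ)) → σ i < σ j

open Classical in
/-- The right hand side of the `n`-th `L_∞`-relation on elements of degrees `a_1, …, a_n`:
the sum over `p + q = n + 1` with `p, q ≥ 2` and over `(q, p - 1)`-shuffles `σ` of
`sgn(σ) (-1)^((p-1) q) l_p ∘ (l_q ⊗ id) ∘ σ⁻¹`. -/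
noncomputable def jacobi (l : ∀ n : ℕ, MultilinearMap ℚ (fun _ : Fin n => V) V) (n : ℕ)
    (a : Fin n → ℤ) : MultilinearMap ℚ (fun _ : Fin n => V) V :=
  ∑ q ∈ (Finset.univ : Finset (Fin n)) with 2 ≤ q.val, ∑ σ : Equiv.Perm (Fin n) with IsShuffle q σ,
    (Equiv.Perm.sign σ * koszulSign σ a * (((n : ℤ) - q) * q).negOnePow) •
      insertOp q q.isLt.le (l (n - q + 1)) (l q) σ

theorem map_boundary {l : ∀ n : ℕ, MultilinearMap ℚ (fun _ : Fin n => V) V}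
    {l' : ∀ n : ℕ, MultilinearMap ℚ (fun _ : Fin n => N) N} (φ : V →ₗ[ℚ] N)
    (hφ : ∀ n x, φ (l n x) = l' n (fun i => φ (x i))) (n : ℕ) (a : Fin n → ℤ) (x : Fin n → V) :
    φ (boundary l n a x) = boundary l' n a (fun i => φ (x i)) := by
  have hd : ∀ y, φ (diff l y) = diff l' (φ y) := fun y => by
    rw [diff_apply, diff_apply, hφ]
  simp only [boundary_apply, map_sub, Units.smul_def, map_zsmul, map_sum, hφ, hd]
  congr! 6 with k _ i
  by_cases hi : i = k
  · subst hi; simp [hd]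
  · simp [hi]

theorem map_jacobi {l : ∀ n : ℕ, MultilinearMap ℚ (fun _ : Fin n => V) V}
    {l' : ∀ n : ℕ, MultilinearMap ℚ (fun _ : Fin n => N) N} (φ : V →ₗ[ℚ] N)
    (hφ : ∀ n x, φ (l n x) = l' n (fun i => φ (x i))) (n : ℕ) (a : Fin n → ℤ) (x : Fin n → V) :
    φ (jacobi l n a x) = jacobi l' n a (fun i => φ (x i)) := by
  simp only [jacobi, sum_apply, smul_apply, insertOp_apply,
    Units.smul_def, map_zsmul, map_sum, hφ]
  congr! 6 with q _ σ _ i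
  refine Fin.cases ?_ (fun j => ?_) i <;> simp [hφ]

theorem boundary_mem {l : ∀ n : ℕ, MultilinearMap ℚ (fun _ : Fin n => V) V}
    {D : ℤ → Submodule ℚ V}
    (hD : ∀ (n : ℕ) (a : Fin n → ℤ) (x : Fin n → V), (∀ i, x i ∈ D (a i)) →
      l n x ∈ D (∑ i, a i + n - 2))
    (n : ℕ) (a : Fin n → ℤ) (x : Fin n → V) (hx : ∀ i, x i ∈ D (a i)) :
    boundary l n a x ∈ D (∑ i, a i + n - 3) := by
  have hd : ∀ b y, y ∈ D b → diff l y ∈ D (b - 1) := fun b y hy => by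
    have := hD 1 (fun _ => b) (fun _ => y) (fun _ => hy)
    rw [diff_apply]
    convert this using 2
    simp; ring
  rw [boundary_apply]
  refine sub_mem ?_ ?_
  · convert hd _ _ (hD n a x hx) using 2
    ring
  · rw [Units.smul_def]
    refine zsmul_mem (sum_mem fun k _ => ?_) _
    rw [Units.smul_def]
    refine zsmul_mem ?_ _
    convert hD n (Function.update a k (a k - 1)) _ ?_ using 2
    · rw [Finset.sum_update_of_mem (Finset.mem_univ k),
        ← Finset.add_sum_erase _ a (Finset.mem_univ k), Finset.sdiff_singleton_eq_erase]
      ring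
    · intro i
      by_cases hi : i = k
      · subst hi; simpa using hd _ _ (hx i)
      · simpa [hi] using hx i

theorem jacobi_mem {l : ∀ n : ℕ, MultilinearMap ℚ (fun _ : Fin n => V) V}
    {D : ℤ → Submodule ℚ V}
    (hD : ∀ (n : ℕ) (a : Fin n → ℤ) (x : Fin n → V), (∀ i, x i ∈ D (a i)) →
      l n x ∈ D (∑ i, a i + n - 2))
    (n : ℕ) (a : Fin n → ℤ) (x : Fin n → V) (hx : ∀ i, x i ∈ D (a i)) :
    jacobi l n a x ∈ D (∑ i, a i + n - 3) := by
  simp only [jacobi, sum_apply, smul_apply, insertOp_apply,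
    Units.smul_def]
  refine sum_mem fun q _ => sum_mem fun σ _ => zsmul_mem ?_ _
  have hq : (q : ℕ) ≤ n := q.isLt.le
  set hd : Fin q → ℤ := fun i => a (σ (Fin.castLE hq i)) with hhd
  set tl : Fin (n - q) → ℤ := fun j => a (σ ⟨q + j, by omega⟩) with htl
  have hsum : ∑ i, a i = ∑ i, hd i + ∑ j, tl j := by
    rw [← Equiv.sum_comp ((finSumFinEquiv.trans (finCongr (Nat.add_sub_of_le hq))).trans σ),
      Fintype.sum_sum_type]
    rfl
  convert hD (n - q + 1) (Fin.cons (∑ i, hd i + q - 2) tl) _ ?_ using 2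
  · rw [Fin.sum_univ_succ, hsum]
    simp only [Fin.cons_zero, Fin.cons_succ]
    push_cast [Nat.cast_sub hq]
    ring
  · intro i
    refine Fin.cases ?_ (fun j => ?_) i
    · simpa using hD q hd _ fun i => hx _
    · simpa using hx _

/-- A multilinear map that vanishes on spanning sets vanishes. -/
theorem multilinear_eq_zero {n : ℕ} (E : MultilinearMap ℚ (fun _ : Fin n => V) N)
    (S : Fin n → Set V) (h : ∀ x : Fin n → V, (∀ j, x j ∈ S j) → E x = 0)
    (x : Fin n → V) (hx : ∀ j, x j ∈ Submodule.span ℚ (S j)) : E x = 0 := by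
  suffices H : ∀ (s : Finset (Fin n)) (x : Fin n → V),
      (∀ j ∈ s, x j ∈ Submodule.span ℚ (S j)) → (∀ j, j ∉ s → x j ∈ S j) → E x = 0 from
    H Finset.univ x (fun j _ => hx j) (fun j hj => absurd (Finset.mem_univ j) hj)
  intro s
  induction s using Finset.induction_on with
  | empty => intro x _ hx'; exact h x fun j => hx' j (by simp)
  | insert k s hk ih =>
    intro x hx1 hx2
    have key : ∀ y ∈ Submodule.span ℚ (S k), E (Function.update x k y) = 0 := by
      intro y hy
      induction hy using Submodule.span_induction with
      | mem y hy =>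
        refine ih _ (fun j hj => ?_) (fun j hj => ?_)
        · have : j ≠ k := fun e => hk (e ▸ hj)
          simpa [this] using hx1 j (by simp [hj])
        · by_cases e : j = k
          · subst e; simpa using hy
          · simpa [e] using hx2 j (by simp [hj, e])
      | zero => exact E.map_update_zero x k
      | add y z _ _ hy hz => rw [E.map_update_add, hy, hz, add_zero]
      | smul c y _ hy => rw [E.map_update_smul, hy, smul_zero]
    simpa using key (x k) (hx1 k (by simp))

/-- Graded pieces detected by projections are in direct sum. -/
theorem isInternal_of_projections (D : ℤ → Submodule ℚ V) (p : ℤ → V →ₗ[ℚ] V)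
    (h1 : ∀ i, ∀ x ∈ D i, p i x = x) (h2 : ∀ i j, j ≠ i → ∀ x ∈ D j, p i x = 0)
    (h3 : ⨆ i, D i = ⊤) : DirectSum.IsInternal D := by
  refine DirectSum.isInternal_submodule_of_iSupIndep_of_iSup_eq_top ?_ h3
  intro i
  rw [Submodule.disjoint_def]
  intro x hx hx'
  have : (⨆ j, ⨆ (_ : j ≠ i), D j) ≤ LinearMap.ker (p i) :=
    iSup₂_le fun j hj x hx => h2 i j hj x hx
  rw [← h1 i x hx]
  exact this hx'


end operations

end LInfty

open LInfty

/-- An `L_∞`-algebra structure on a rational vector space `V`: a grading `V = ⨁ V_i` by integers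
(homological degree), operations `l_n` of degree `n - 2` with `l_1 = d` a differential, graded
antisymmetric, subject to the `L_∞`-relations. There is no operation of arity `0`. -/
structure LInftyAlgebra (V : Type v) [AddCommGroup V] [Module ℚ V] where
  /-- `deg i` is the homogeneous component `V_i`. -/
  deg : ℤ → Submodule ℚ V
  internal : DirectSum.IsInternal deg
  /-- The operations `l_n`; the differential is `l_1`. -/
  l : ∀ n : ℕ, MultilinearMap ℚ (fun _ : Fin n => V) V
  l_zero : l 0 = 0
  l_mem : ∀ (n : ℕ) (a : Fin n → ℤ) (x : Fin n → V), (∀ i, x i ∈ deg (a i)) →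
    l n x ∈ deg (∑ i, a i + n - 2)
  antisymm : ∀ (n : ℕ) (a : Fin n → ℤ) (x : Fin n → V), (∀ i, x i ∈ deg (a i)) →
    ∀ σ : Equiv.Perm (Fin n),
      (Equiv.Perm.sign σ * koszulSign σ a) • l n (fun i => x (σ i)) = l n x
  d_d : ∀ x, diff l (diff l x) = 0
  relation : ∀ n : ℕ, 2 ≤ n → ∀ (a : Fin n → ℤ) (x : Fin n → V), (∀ i, x i ∈ deg (a i)) →
    boundary l n a x = jacobi l n a x

namespace LInftyAlgebra

section basic

variable {V : Type v} [AddCommGroup V] [Module ℚ V]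
variable {V' : Type w} [AddCommGroup V'] [Module ℚ V']

/-- The differential `d = l_1`. -/
def d (L : LInftyAlgebra V) : V →ₗ[ℚ] V := diff L.l

/-- An `L_∞`-algebra is minimal if its differential is trivial. -/
def IsMinimal (L : LInftyAlgebra V) : Prop := L.d = 0

/-- Strict morphisms: linear maps of degree `0` that commute with all operations, including `d`. -/
structure StrictHom (L : LInftyAlgebra V) (L' : LInftyAlgebra V') where
  toLinearMap : V →ₗ[ℚ] V'
  map_deg : ∀ i, ∀ x ∈ L.deg i, toLinearMap x ∈ L'.deg i
  map_l : ∀ (n : ℕ) (x : Fin n → V),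
    toLinearMap (L.l n x) = L'.l n (fun i => toLinearMap (x i))

end basic

end LInftyAlgebra

namespace FreeLInfty

/-- Formal iterated operations applied to homogeneous elements of the graded vector space `W`. -/
inductive Term (W : ℤ → Type u) : Type u
  | gen (i : ℤ) (w : W i) : Term W
  | op (n : ℕ) (t : Fin n → Term W) : Term W

namespace Term

section

variable {W : ℤ → Type u}

/-- The degree of a formal operation; the operation of arity `n` has degree `n - 2`. -/
def degree : Term W → ℤ
  | gen i _ => i
  | op n t => ∑ k, (t k).degree + n - 2

/-- The value of a formal operation in an `L_∞`-algebra. -/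
def eval {V : Type v} [AddCommGroup V] [Module ℚ V] (L : LInftyAlgebra V) (φ : ∀ i, W i → V) :
    Term W → V
  | gen i w => φ i w
  | op n t => L.l n fun k => (t k).eval L φ

end

end Term

section

/-- The vector space with basis the formal iterated operations. -/
abbrev Pre (W : ℤ → Type u) : Type u := Term W →₀ ℚ

variable {W : ℤ → Type u}

/-- The basis vector of a formal operation. -/
noncomputable def single (t : Term W) : Pre W := Finsupp.single t 1

open Classical in
/-- The multilinear extension of the formal operations. -/
noncomputable def preOp (n : ℕ) : MultilinearMap ℚ (fun _ : Fin n => Pre W) (Pre W) :=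
  (MultilinearMap.fromDFinsuppEquiv (fun _ : Fin n => Term W) ℚ (M := fun _ _ => ℚ)
    (fun t => MultilinearMap.mkPiRing ℚ (Fin n) (single (Term.op n t)))).compLinearMap
    fun _ => (finsuppLequivDFinsupp ℚ).toLinearMap

theorem preOp_single {n : ℕ} (t : Fin n → Term W) :
    preOp n (fun i => single (t i)) = single (Term.op n t) := by
  classical
  simp only [preOp, single, MultilinearMap.compLinearMap_apply, LinearEquiv.coe_coe,
    finsuppLequivDFinsupp_apply_apply, Finsupp.toDFinsupp_single]
  rw [MultilinearMap.fromDFinsuppEquiv_single]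
  simp

theorem span_single : Submodule.span ℚ (Set.range (single (W := W))) = ⊤ := by
  have h : (single : Term W → Pre W) = Finsupp.basisSingleOne (R := ℚ) := by
    funext t; simp [single]
  rw [h]
  exact Module.Basis.span_eq _

variable (W) in
/-- The part of degree `i`. -/
noncomputable def preDeg (i : ℤ) : Submodule ℚ (Pre W) :=
  Submodule.span ℚ (single '' {t | t.degree = i})

theorem preOp_mem (n : ℕ) (a : Fin n → ℤ) (x : Fin n → Pre W) (hx : ∀ i, x i ∈ preDeg W (a i)) :
    preOp n x ∈ preDeg W (∑ i, a i + n - 2) := by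
  have := multilinear_eq_zero ((preDeg W (∑ i, a i + n - 2)).mkQ.compMultilinearMap (preOp n))
    (fun j => single '' {t | t.degree = a j}) (fun y hy => ?_) x hx
  · simpa using this
  · choose t ht hty using hy
    obtain rfl : (fun i => single (t i)) = y := funext hty
    simp only [LinearMap.compMultilinearMap_apply, preOp_single, Submodule.mkQ_apply,
      Submodule.Quotient.mk_eq_zero]
    refine Submodule.subset_span ⟨_, ?_, rfl⟩
    simp only [Set.mem_ofPred_eq] at ht
    simp [Term.degree, ht]

theorem diff_mem (i : ℤ) (x : Pre W) (hx : x ∈ preDeg W i) :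
    diff preOp x ∈ preDeg W (i - 1) := by
  rw [diff_apply]
  convert preOp_mem 1 (fun _ => i) (fun _ => x) (fun _ => hx) using 2
  simp; ring

theorem single_mem (t : Term W) : single t ∈ preDeg W t.degree :=
  Submodule.subset_span ⟨t, rfl, rfl⟩

/-- The projection to degree `i`. -/
noncomputable def preProj (i : ℤ) : Pre W →ₗ[ℚ] Pre W :=
  Finsupp.lift (Pre W) ℚ (Term W) fun t => if t.degree = i then single t else 0

theorem preProj_single (i : ℤ) (t : Term W) :
    preProj i (single t) = if t.degree = i then single t else 0 := by
  simp [preProj, single]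

theorem preProj_of_mem (i j : ℤ) (x : Pre W) (hx : x ∈ preDeg W j) :
    preProj i x = if j = i then x else 0 := by
  induction hx using Submodule.span_induction with
  | mem x hx =>
    obtain ⟨t, rfl, rfl⟩ := hx
    exact preProj_single i t
  | zero => simp
  | add x y _ _ hx hy => rw [map_add, hx, hy]; split_ifs <;> simp
  | smul c x _ hx => rw [map_smul, hx]; split_ifs <;> simp

variable [∀ i, AddCommGroup (W i)] [∀ i, Module ℚ (W i)]

/-- The relations of the free `L_∞`-algebra: linearity in the generators, vanishing of the
differential on generators, the axioms of an `L_∞`-algebra for all formal operations, and their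
consequences under further operations. -/
inductive Relator : Pre W → Prop
  | gen_add (i : ℤ) (v w : W i) :
      Relator (single (.gen i (v + w)) - (single (.gen i v) + single (.gen i w)))
  | gen_smul (i : ℤ) (c : ℚ) (w : W i) :
      Relator (single (.gen i (c • w)) - c • single (.gen i w))
  | d_gen (i : ℤ) (w : W i) : Relator (diff preOp (single (.gen i w)))
  | op_zero (t : Fin 0 → Term W) : Relator (preOp 0 fun i => single (t i))
  | antisymm (n : ℕ) (t : Fin n → Term W) (σ : Equiv.Perm (Fin n)) :
      Relator ((Equiv.Perm.sign σ * koszulSign σ fun i => (t i).degree) •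
        preOp n (fun i => single (t (σ i))) - preOp n fun i => single (t i))
  | d_d (t : Term W) : Relator (diff preOp (diff preOp (single t)))
  | relation (n : ℕ) (hn : 2 ≤ n) (t : Fin n → Term W) :
      Relator (boundary preOp n (fun i => (t i).degree) (fun i => single (t i)) -
        jacobi preOp n (fun i => (t i).degree) (fun i => single (t i)))
  | op_closed (n : ℕ) (t : Fin n → Term W) (k : Fin n) (r : Pre W) : Relator r →
      Relator (preOp n (Function.update (fun i => single (t i)) k r))

variable (W) in
/-- The ideal generated by the relations. -/
noncomputable def ideal : Submodule ℚ (Pre W) := Submodule.span ℚ {r | Relator r}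

theorem preOp_mem_ideal (n : ℕ) (x : Fin n → Pre W) (k : Fin n) (hk : x k ∈ ideal W) :
    preOp n x ∈ ideal W := by
  have := multilinear_eq_zero ((ideal W).mkQ.compMultilinearMap (preOp n))
    (Function.update (fun _ => Set.range single) k {r | Relator r}) (fun y hy => ?_) x
    (fun j => ?_)
  · simpa using this
  · have hyk : Relator (y k) := by simpa using hy k
    have : ∀ j, ∃ t, j ≠ k → single t = y j := by
      intro j
      by_cases hj : j = k
      · exact ⟨.op 0 Fin.elim0, fun h => absurd hj h⟩
      · obtain ⟨t, ht⟩ : y j ∈ Set.range single := by simpa [hj] using hy j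
        exact ⟨t, fun _ => ht⟩
    choose t ht using this
    have hy' : y = Function.update (fun i => single (t i)) k (y k) := by
      funext j
      by_cases hj : j = k
      · subst hj; simp
      · simp [hj, ht j hj]
    simp only [LinearMap.compMultilinearMap_apply, Submodule.mkQ_apply,
      Submodule.Quotient.mk_eq_zero]
    rw [hy']
    exact Submodule.subset_span (Relator.op_closed n t k _ hyk)
  · by_cases hj : j = k
    · subst hj; simpa [ideal] using hk
    · simp [hj, span_single]

theorem Relator.exists_mem_preDeg {r : Pre W} (h : Relator r) : ∃ i, r ∈ preDeg W i := by
  induction h with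
  | gen_add i v w =>
    exact ⟨i, sub_mem (single_mem (.gen i _)) (add_mem (single_mem (.gen i _))
      (single_mem (.gen i _)))⟩
  | gen_smul i c w =>
    exact ⟨i, sub_mem (single_mem (.gen i _)) (Submodule.smul_mem _ _ (single_mem (.gen i _)))⟩
  | d_gen i w => exact ⟨_, diff_mem i _ (single_mem (.gen i w))⟩
  | op_zero t => exact ⟨_, preOp_mem 0 _ _ fun i => single_mem (t i)⟩
  | antisymm n t σ =>
    refine ⟨_, sub_mem ?_ (preOp_mem n _ _ fun i => single_mem (t i))⟩
    rw [Units.smul_def]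
    refine zsmul_mem ?_ _
    have := preOp_mem n _ _ fun i => single_mem (t (σ i))
    rwa [Equiv.sum_comp σ (fun i => (t i).degree)] at this
  | d_d t => exact ⟨_, diff_mem _ _ (diff_mem _ _ (single_mem t))⟩
  | relation n hn t =>
    exact ⟨_, sub_mem (boundary_mem preOp_mem n _ _ fun i => single_mem (t i))
      (jacobi_mem preOp_mem n _ _ fun i => single_mem (t i))⟩
  | op_closed n t k r _ ih =>
    obtain ⟨i, hi⟩ := ih
    refine ⟨_, preOp_mem n (Function.update (fun j => (t j).degree) k i) _ fun j => ?_⟩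
    by_cases hj : j = k
    · subst hj; simpa using hi
    · simpa [hj] using single_mem (t j)

end

end FreeLInfty

/-- The underlying vector space of the free `L_∞`-algebra on the graded vector space
`W = {W_i}`, regarded as a complex with zero differential. -/
def FreeLInfty (W : ℤ → Type u) [∀ i, AddCommGroup (W i)] [∀ i, Module ℚ (W i)] : Type u := FreeLInfty.Pre W ⧸ FreeLInfty.ideal W

namespace FreeLInfty

section

variable (W : ℤ → Type u) [∀ i, AddCommGroup (W i)] [∀ i, Module ℚ (W i)]

noncomputable instance : AddCommGroup (FreeLInfty W) :=
  inferInstanceAs (AddCommGroup (Pre W ⧸ ideal W))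

noncomputable instance : Module ℚ (FreeLInfty W) :=
  inferInstanceAs (Module ℚ (Pre W ⧸ ideal W))

/-- The quotient map. -/
noncomputable def mk : Pre W →ₗ[ℚ] FreeLInfty W := (ideal W).mkQ

variable {W}

theorem mk_surjective : Function.Surjective (mk W) := Submodule.mkQ_surjective _

theorem mk_eq_zero {x : Pre W} : mk W x = 0 ↔ x ∈ ideal W := Submodule.Quotient.mk_eq_zero _

theorem mk_preOp_congr {n : ℕ} (x y : Fin n → Pre W) (h : ∀ i, mk W (x i) = mk W (y i)) :
    mk W (preOp n x) = mk W (preOp n y) := by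
  suffices H : ∀ (s : Finset (Fin n)), mk W (preOp n (s.piecewise y x)) = mk W (preOp n x) by
    simpa using (H Finset.univ).symm
  intro s
  induction s using Finset.induction_on with
  | empty => simp
  | insert k s hk ih =>
    rw [← ih, Finset.piecewise_insert, ← sub_eq_zero, ← map_sub]
    conv_lhs =>
      enter [2, 2, 2]
      rw [← Function.update_eq_self k (s.piecewise y x)]
    rw [← MultilinearMap.map_update_sub, mk_eq_zero]
    refine preOp_mem_ideal n _ k ?_
    simp [hk, ← mk_eq_zero, h]

/-- The operations of the free algebra. -/
noncomputable def op (n : ℕ) : MultilinearMap ℚ (fun _ : Fin n => FreeLInfty W) (FreeLInfty W) where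
  toFun x := mk W (preOp n fun i => Function.surjInv mk_surjective (x i))
  map_update_add' {dec} x k u v := by
    obtain rfl : dec = instDecidableEqFin n := Subsingleton.elim _ _
    set s := Function.surjInv (mk_surjective (W := W)) with hs
    have hs' : ∀ z, mk W (s z) = z := Function.surjInv_eq mk_surjective
    have e : ∀ z p, mk W p = z → mk W (preOp n fun i => s (Function.update x k z i)) =
        mk W (preOp n (Function.update (fun i => s (x i)) k p)) := by
      intro z p hp
      refine mk_preOp_congr _ _ fun i => ?_
      by_cases hi : i = k
      · subst hi; simp [hs', hp]
      · simp [hi]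
    rw [e (u + v) (s u + s v) (by simp [hs']), e u (s u) (hs' u), e v (s v) (hs' v),
      MultilinearMap.map_update_add, map_add]
  map_update_smul' {dec} x k c u := by
    obtain rfl : dec = instDecidableEqFin n := Subsingleton.elim _ _
    set s := Function.surjInv (mk_surjective (W := W)) with hs
    have hs' : ∀ z, mk W (s z) = z := Function.surjInv_eq mk_surjective
    have e : ∀ z p, mk W p = z → mk W (preOp n fun i => s (Function.update x k z i)) =
        mk W (preOp n (Function.update (fun i => s (x i)) k p)) := by
      intro z p hp
      refine mk_preOp_congr _ _ fun i => ?_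
      by_cases hi : i = k
      · subst hi; simp [hs', hp]
      · simp [hi]
    rw [e (c • u) (c • s u) (by simp [hs']), e u (s u) (hs' u),
      MultilinearMap.map_update_smul, map_smul]

theorem mk_preOp (n : ℕ) (x : Fin n → Pre W) :
    mk W (preOp n x) = op n (fun i => mk W (x i)) :=
  mk_preOp_congr _ _ fun _ => (Function.surjInv_eq mk_surjective _).symm

variable (W) in
/-- The homogeneous components of the free algebra. -/
noncomputable def deg (i : ℤ) : Submodule ℚ (FreeLInfty W) := (preDeg W i).map (mk W)

theorem deg_eq_span (i : ℤ) :
    deg W i = Submodule.span ℚ ((fun t => mk W (single t)) '' {t | t.degree = i}) := by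
  rw [deg, preDeg, Submodule.map_span, Set.image_image]

theorem internal : DirectSum.IsInternal (deg W) := by
  have hker : ∀ i, ideal W ≤ LinearMap.ker ((mk W) ∘ₗ preProj i) := by
    intro i
    refine Submodule.span_le.2 fun r hr => ?_
    obtain ⟨j, hj⟩ := Relator.exists_mem_preDeg hr
    simp only [SetLike.mem_coe, LinearMap.mem_ker, LinearMap.comp_apply, preProj_of_mem i j r hj]
    split_ifs
    · exact mk_eq_zero.2 (Submodule.subset_span hr)
    · simp
  have hp : ∀ i x, (ideal W).liftQ _ (hker i) (mk W x) = mk W (preProj i x) := fun i x => rfl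
  refine isInternal_of_projections (deg W) (fun i => (ideal W).liftQ _ (hker i)) ?_ ?_ ?_
  · rintro i _ ⟨x, hx, rfl⟩
    refine (hp i x).trans ?_
    rw [preProj_of_mem i i x hx, if_pos rfl]
  · rintro i j hij _ ⟨x, hx, rfl⟩
    refine (hp i x).trans ?_
    rw [preProj_of_mem i j x hx, if_neg hij, map_zero]
  · rw [eq_top_iff]
    rintro x -
    obtain ⟨x, rfl⟩ := mk_surjective x
    have hx : x ∈ Submodule.span ℚ (Set.range (single (W := W))) := by simp [span_single]
    induction hx using Submodule.span_induction with
    | mem x hx =>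
      obtain ⟨t, rfl⟩ := hx
      exact Submodule.mem_iSup_of_mem t.degree ⟨_, single_mem t, rfl⟩
    | zero => simp
    | add x y _ _ hx hy => rw [map_add]; exact add_mem hx hy
    | smul c x _ hx => rw [map_smul]; exact Submodule.smul_mem _ _ hx

theorem op_mem (n : ℕ) (a : Fin n → ℤ) (x : Fin n → FreeLInfty W) (hx : ∀ i, x i ∈ deg W (a i)) :
    op n x ∈ deg W (∑ i, a i + n - 2) := by
  choose y hy hyx using hx
  obtain rfl : (fun i => mk W (y i)) = x := funext hyx
  rw [← mk_preOp]
  exact ⟨_, preOp_mem n a y hy, rfl⟩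

/-- Multilinear identities in the free algebra can be checked on classes of formal operations. -/
theorem eq_of_terms {n : ℕ} (a : Fin n → ℤ)
    (E E' : MultilinearMap ℚ (fun _ : Fin n => FreeLInfty W) (FreeLInfty W))
    (h : ∀ t : Fin n → Term W, (∀ i, (t i).degree = a i) →
      E (fun i => mk W (single (t i))) = E' (fun i => mk W (single (t i))))
    (x : Fin n → FreeLInfty W) (hx : ∀ i, x i ∈ deg W (a i)) : E x = E' x := by
  rw [← sub_eq_zero, ← sub_apply]
  refine multilinear_eq_zero (E - E') (fun i => (fun t => mk W (single t)) '' {t | t.degree = a i})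
    (fun y hy => ?_) x fun i => ?_
  · choose t ht hty using hy
    obtain rfl : (fun i => mk W (single (t i))) = y := funext hty
    rw [sub_apply, sub_eq_zero]
    exact h t ht
  · rw [← deg_eq_span]
    exact hx i

theorem mk_relator {r : Pre W} (h : Relator r) : mk W r = 0 :=
  mk_eq_zero.2 (Submodule.subset_span h)

theorem mk_diff (x : Pre W) : mk W (diff preOp x) = diff op (mk W x) := by
  rw [diff_apply, diff_apply, mk_preOp]

variable (W) in
/-- The free `L_∞`-algebra on `W`. -/
noncomputable def algebra : LInftyAlgebra (FreeLInfty W) where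
  deg := deg W
  internal := internal
  l := op
  l_zero := by
    ext x
    obtain rfl : x = fun i => mk W (single (Fin.elim0 (α := Term W) i)) := funext fun i => i.elim0
    rw [← mk_preOp]
    exact mk_relator (.op_zero _)
  l_mem := op_mem
  antisymm n a x hx σ := by
    have := eq_of_terms a ((Equiv.Perm.sign σ * koszulSign σ a) • (op n).domDomCongr σ) (op n)
      (fun t ht => ?_) x hx
    · exact this
    · obtain rfl : (fun i => (t i).degree) = a := funext ht
      have := mk_relator (.antisymm n t σ)
      rw [map_sub, sub_eq_zero, Units.smul_def, map_zsmul, mk_preOp, mk_preOp] at this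
      exact this
  d_d x := by
    obtain ⟨x, rfl⟩ := mk_surjective x
    have hx : x ∈ Submodule.span ℚ (Set.range (single (W := W))) := by simp [span_single]
    induction hx using Submodule.span_induction with
    | mem x hx =>
      obtain ⟨t, rfl⟩ := hx
      rw [← mk_diff, ← mk_diff]
      exact mk_relator (.d_d t)
    | zero => simp
    | add x y _ _ hx hy => rw [map_add, map_add, map_add, hx, hy, add_zero]
    | smul c x _ hx => rw [map_smul, map_smul, map_smul, hx, smul_zero]
  relation n hn a x hx := by
    refine eq_of_terms a (boundary op n a) (jacobi op n a) (fun t ht => ?_) x hx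
    obtain rfl : (fun i => (t i).degree) = a := funext ht
    have := mk_relator (.relation n hn t)
    rwa [map_sub, sub_eq_zero, map_boundary (mk W) mk_preOp, map_jacobi (mk W) mk_preOp] at this

variable (W) in
/-- The inclusion of generators. -/
noncomputable def ι (i : ℤ) : W i →ₗ[ℚ] FreeLInfty W where
  toFun w := mk W (single (.gen i w))
  map_add' v w := by
    rw [← sub_eq_zero, ← map_add, ← map_sub]
    exact mk_relator (.gen_add i v w)
  map_smul' c w := by
    rw [RingHom.id_apply, ← sub_eq_zero, ← map_smul, ← map_sub]
    exact mk_relator (.gen_smul i c w)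

section lift

variable {V : Type v} [AddCommGroup V] [Module ℚ V] (L : LInftyAlgebra V)
  (φ : ∀ i, W i →ₗ[ℚ] V)

/-- The linear extension of evaluation in `L`. -/
noncomputable def preLift : Pre W →ₗ[ℚ] V :=
  Finsupp.lift V ℚ (Term W) (Term.eval L fun i => φ i)

theorem preLift_single (t : Term W) : preLift L φ (single t) = t.eval L fun i => φ i := by
  simp [preLift, single]

theorem preLift_preOp (n : ℕ) (x : Fin n → Pre W) :
    preLift L φ (preOp n x) = L.l n fun i => preLift L φ (x i) := by
  rw [← sub_eq_zero]
  refine multilinear_eq_zero ((preLift L φ).compMultilinearMap (preOp n) -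
    (L.l n).compLinearMap fun _ => preLift L φ) (fun _ => Set.range single)
    (fun y hy => ?_) x fun i => by simp [span_single]
  choose t ht using hy
  obtain rfl : (fun i => single (t i)) = y := funext ht
  simp [preOp_single, preLift_single, Term.eval]

theorem eval_mem (hφ : ∀ i w, φ i w ∈ L.deg i) (t : Term W) : t.eval L (fun i => φ i) ∈ L.deg t.degree := by
  induction t with
  | gen i w => exact hφ i w
  | op n t ih => exact L.l_mem n _ _ ih

theorem preLift_relator (hφ : ∀ i w, φ i w ∈ L.deg i) (hd : ∀ i w, L.d (φ i w) = 0) {r : Pre W} (h : Relator r) : preLift L φ r = 0 := by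
  have hdiff : ∀ x, preLift L φ (diff preOp x) = L.d (preLift L φ x) := fun x => by
    rw [LInftyAlgebra.d, diff_apply, diff_apply, preLift_preOp]
  have hm : ∀ t, preLift L φ (single t) ∈ L.deg t.degree := fun t => by
    rw [preLift_single]; exact eval_mem L φ hφ t
  induction h with
  | gen_add i v w => simp [preLift_single, Term.eval]
  | gen_smul i c w => simp [preLift_single, Term.eval]
  | d_gen i w => rw [hdiff, preLift_single]; exact hd i w
  | op_zero t => rw [preLift_preOp, L.l_zero]; rfl
  | antisymm n t σ =>
    rw [map_sub, sub_eq_zero, Units.smul_def, map_zsmul, preLift_preOp, preLift_preOp]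
    exact L.antisymm n _ (fun i => preLift L φ (single (t i))) (fun i => hm (t i)) σ
  | d_d t => rw [hdiff, hdiff]; exact L.d_d _
  | relation n hn t =>
    rw [map_sub, sub_eq_zero, map_boundary _ (preLift_preOp L φ),
      map_jacobi _ (preLift_preOp L φ)]
    exact L.relation n hn _ _ fun i => hm (t i)
  | op_closed n t k r _ ih =>
    rw [preLift_preOp]
    exact (L.l n).map_coord_zero k (by simp [ih])

/-- The universal property: a degree preserving linear map from `W` to the cycles of an
`L_∞`-algebra `L` extends to a strict morphism from the free `L_∞`-algebra on `W`, uniquely so by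
`hom_ext`. -/
noncomputable def lift (hφ : ∀ i w, φ i w ∈ L.deg i) (hd : ∀ i w, L.d (φ i w) = 0) : (algebra W).StrictHom L where
  toLinearMap := (ideal W).liftQ (preLift L φ)
    (Submodule.span_le.2 fun _ hr => preLift_relator L φ hφ hd hr)
  map_deg := by
    rintro i _ ⟨x, hx, rfl⟩
    change preLift L φ x ∈ L.deg i
    induction hx using Submodule.span_induction with
    | mem x hx =>
      obtain ⟨t, rfl, rfl⟩ := hx
      rw [preLift_single]; exact eval_mem L φ hφ t
    | zero => simp
    | add x y _ _ hx hy => rw [map_add]; exact add_mem hx hy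
    | smul c x _ hx => rw [map_smul]; exact Submodule.smul_mem _ _ hx
  map_l n x := by
    choose y hy using fun i => mk_surjective (x i)
    obtain rfl : (fun i => mk W (y i)) = x := funext hy
    change _ = L.l n fun i => preLift L φ (y i)
    rw [← preLift_preOp]
    change (ideal W).liftQ _ _ (op n fun i => mk W (y i)) = _
    rw [← mk_preOp]
    rfl

theorem lift_ι (hφ : ∀ i w, φ i w ∈ L.deg i) (hd : ∀ i w, L.d (φ i w) = 0) (i : ℤ) (w : W i) : (lift L φ hφ hd).toLinearMap (ι W i w) = φ i w :=
  preLift_single L φ (.gen i w)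

theorem hom_ext {f g : (algebra W).StrictHom L}
    (h : ∀ i w, f.toLinearMap (ι W i w) = g.toLinearMap (ι W i w)) : f = g := by
  have ht : ∀ t : Term W, f.toLinearMap (mk W (single t)) = g.toLinearMap (mk W (single t)) := by
    intro t
    induction t with
    | gen i w => exact h i w
    | op n t ih =>
      rw [← preOp_single, mk_preOp]
      have hf := f.map_l n fun i => mk W (single (t i))
      have hg := g.map_l n fun i => mk W (single (t i))
      simp only [ih] at hf
      exact hf.trans hg.symm
  have : f.toLinearMap = g.toLinearMap := by
    refine LinearMap.ext fun x => ?_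
    obtain ⟨x, rfl⟩ := mk_surjective x
    have hx : x ∈ Submodule.span ℚ (Set.range (single (W := W))) := by simp [span_single]
    induction hx using Submodule.span_induction with
    | mem x hx => obtain ⟨t, rfl⟩ := hx; exact ht t
    | zero => simp
    | add x y _ _ hx hy => rw [map_add, map_add, map_add, hx, hy]
    | smul c x _ hx => rw [map_smul, map_smul, map_smul, hx]
  cases f; cases g; congr

end lift

end

end FreeLInfty

namespace LInftyAlgebra

section chevalleyEilenberg

open scoped TensorProduct DirectSum

variable {V : Type v} [AddCommGroup V] [Module ℚ V] (L : LInftyAlgebra V)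
variable {N : Type w} [AddCommGroup N] [Module ℚ N]

/-- The multilinear map that is given by `f a` on homogeneous elements of degrees `a_1, …, a_n`;
see `ofHomogeneous_apply`. -/
noncomputable def ofHomogeneous {n : ℕ}
    (f : (Fin n → ℤ) → MultilinearMap ℚ (fun _ : Fin n => V) N) :
    MultilinearMap ℚ (fun _ : Fin n => V) N :=
  letI := L.internal.chooseDecomposition
  (MultilinearMap.fromDFinsuppEquiv (fun _ : Fin n => ℤ) ℚ (M := fun _ i => L.deg i)
    (fun a => (f a).compLinearMap fun k => (L.deg (a k)).subtype)).compLinearMap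
    fun _ => (DirectSum.decomposeLinearEquiv L.deg).toLinearMap

theorem ofHomogeneous_apply {n : ℕ}
    (f : (Fin n → ℤ) → MultilinearMap ℚ (fun _ : Fin n => V) N)
    (a : Fin n → ℤ) (x : Fin n → V) (hx : ∀ i, x i ∈ L.deg (a i)) :
    L.ofHomogeneous f x = f a x := by
  let := L.internal.chooseDecomposition
  have h : ∀ i, DirectSum.decompose L.deg (x i) =
      DFinsupp.single (β := fun j => L.deg j) (a i) ⟨x i, hx i⟩ := fun i =>
    DirectSum.decompose_of_mem L.deg (hx i)
  simp only [ofHomogeneous, MultilinearMap.compLinearMap_apply, LinearEquiv.coe_coe,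
    DirectSum.decomposeLinearEquiv_apply, h]
  erw [MultilinearMap.fromDFinsuppEquiv_single]
  rfl

/-- The subspace of `V^⊗n = (sV)^⊗n` (with the suspension `s` left implicit) spanned by the
differences `y - σ y` for the action of the symmetric group on `(sV)^⊗n` with its Koszul signs;
here `s x` has degree `|x| + 1`. -/
noncomputable def symRel (n : ℕ) : Submodule ℚ (⨂[ℚ] _ : Fin n, V) :=
  Submodule.span ℚ {z | ∃ (a : Fin n → ℤ) (x : Fin n → V) (σ : Equiv.Perm (Fin n)),
    (∀ i, x i ∈ L.deg (a i)) ∧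
    z = PiTensorProduct.tprod ℚ x -
      koszulSign σ (fun i => a i + 1) • PiTensorProduct.tprod ℚ (fun i => x (σ i))}

/-- The coinvariants of `(sV)^⊗n` under the symmetric group on `n` letters. -/
abbrev SymPower (n : ℕ) : Type v := (⨂[ℚ] _ : Fin n, V) ⧸ L.symRel n

/-- The space underlying the Chevalley-Eilenberg complex: the symmetric coalgebra
`⨁_{n ≥ 0} ((sV)^⊗n)_{S_n}`. -/
def CE : Type v := ⨁ n : ℕ, L.SymPower n

noncomputable instance : AddCommGroup L.CE :=
  inferInstanceAs (AddCommGroup (⨁ n : ℕ, L.SymPower n))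

noncomputable instance : Module ℚ L.CE :=
  inferInstanceAs (Module ℚ (⨁ n : ℕ, L.SymPower n))

/-- The inclusion of a summand. -/
noncomputable def incl (n : ℕ) : L.SymPower n →ₗ[ℚ] L.CE := DirectSum.lof ℚ ℕ L.SymPower n

/-- The element `s x_1 ⋯ s x_n` of the symmetric coalgebra. -/
noncomputable def word (n : ℕ) : MultilinearMap ℚ (fun _ : Fin n => V) L.CE :=
  (L.incl n ∘ₗ (L.symRel n).mkQ).compMultilinearMap (PiTensorProduct.tprod ℚ)

/-- The sign in the component `(s x_1, …, s x_n) ↦ ± s l_n (x_1, …, x_n)` of the Chevalley-Eilenberg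
differential for `x_i` of degree `a_i`: it is `(-1)^(∑ (n - i) |x_i|)` for `n ≥ 2`, and
`s x ↦ - s d x` for `n = 1`. -/
def suspSign (n : ℕ) (a : Fin n → ℤ) : ℤˣ :=
  (if n = 1 then -1 else 1) * (∑ i, ((n : ℤ) - 1 - i) * a i).negOnePow

open scoped Nat in
/-- The Chevalley-Eilenberg differential `d + b` on `s x_1 ⋯ s x_n` with `x_i` of degree `a_i`.
It is the coderivation with the components `(s x_1, …, s x_q) ↦ ± s l_q (x_1, …, x_q)`, that is,
`∑_q ∑_σ ε(σ; s x) (± s l_q (x_σ(1), …, x_σ(q))) s x_σ(q+1) ⋯ s x_σ(n)`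
over `(q, n - q)`-shuffles `σ`. By antisymmetry of `l_q` and by the symmetry of words, the summand
depends only on the set of the first `q` letters, so the sum is written symmetrically as the sum
over all permutations divided by `q! (n - q)!`. The term for `q = 0` vanishes since `l_0 = 0`. -/
noncomputable def ceHomogeneous (n : ℕ) (a : Fin n → ℤ) :
    MultilinearMap ℚ (fun _ : Fin n => V) L.CE :=
  ∑ q : Fin (n + 1), ((q.val ! * (n - q.val)! : ℕ) : ℚ)⁻¹ • ∑ σ : Equiv.Perm (Fin n),
    (koszulSign σ (fun i => a i + 1) *
        suspSign q (fun i => a (σ (Fin.castLE q.is_le i)))) •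
      insertOp q q.is_le (L.word (n - q + 1)) (L.l q) σ

theorem ceHomogeneous_comp (n : ℕ) (a : Fin n → ℤ) (x : Fin n → V) (τ : Equiv.Perm (Fin n)) :
    koszulSign τ (fun i => a i + 1) • L.ceHomogeneous n (fun i => a (τ i)) (fun i => x (τ i)) =
      L.ceHomogeneous n a x := by
  simp only [ceHomogeneous, sum_apply, smul_apply, Finset.smul_sum]
  refine Finset.sum_congr rfl fun q _ => ?_
  refine Eq.trans (Finset.sum_congr rfl fun σ _ => ?_) (Equiv.sum_comp (Equiv.mulLeft τ) _)
  rw [smul_comm, smul_smul, ← mul_assoc, Equiv.coe_mulLeft, koszulSign_mul]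
  rfl

/-- The Chevalley-Eilenberg differential as a multilinear map of arbitrary elements. -/
noncomputable def ceMultilinear (n : ℕ) : MultilinearMap ℚ (fun _ : Fin n => V) L.CE :=
  L.ofHomogeneous (L.ceHomogeneous n)

theorem symRel_le (n : ℕ) : L.symRel n ≤ LinearMap.ker (PiTensorProduct.lift (L.ceMultilinear n)) := by
  refine Submodule.span_le.2 ?_
  rintro _ ⟨a, x, σ, hx, rfl⟩
  simp only [SetLike.mem_coe, LinearMap.mem_ker, map_sub, Units.smul_def, map_zsmul,
    PiTensorProduct.lift.tprod, ceMultilinear]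
  rw [L.ofHomogeneous_apply _ a x hx,
    L.ofHomogeneous_apply _ (fun i => a (σ i)) (fun i => x (σ i)) fun i => hx (σ i),
    sub_eq_zero, ← Units.smul_def, ceHomogeneous_comp]

/-- The Chevalley-Eilenberg differential `d + b`; see `ceDiff_word`. -/
noncomputable def ceDiff : L.CE →ₗ[ℚ] L.CE :=
  DirectSum.toModule ℚ ℕ L.CE fun n =>
    (L.symRel n).liftQ (PiTensorProduct.lift (L.ceMultilinear n)) (L.symRel_le n)

theorem ceDiff_word (n : ℕ) (a : Fin n → ℤ) (x : Fin n → V) (hx : ∀ i, x i ∈ L.deg (a i)) :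
    L.ceDiff (L.word n x) = L.ceHomogeneous n a x := by
  rw [← L.ofHomogeneous_apply _ a x hx]
  have h := DirectSum.toModule_lof ℚ (ι := ℕ) (M := L.SymPower) (N := L.CE)
    (φ := fun n => (L.symRel n).liftQ (PiTensorProduct.lift (L.ceMultilinear n)) (L.symRel_le n))
    n ((L.symRel n).mkQ (PiTensorProduct.tprod ℚ x))
  refine h.trans ?_
  rw [Submodule.mkQ_apply, Submodule.liftQ_apply, PiTensorProduct.lift.tprod]
  rfl

/-- A weight grading `V = ⨁_{w ≥ 1} V^w` of an `L_∞`-algebra by graded subspaces, such that `l_n`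
is homogeneous of weight `2 - n`. -/
structure WeightGrading where
  /-- `wt w` is the part of weight `w`. -/
  wt : ℤ → Submodule ℚ V
  internal : DirectSum.IsInternal wt
  wt_eq_bot : ∀ w ≤ 0, wt w = ⊥
  homogeneous : ∀ w, wt w = ⨆ i, wt w ⊓ L.deg i
  l_mem : ∀ (n : ℕ) (w : Fin n → ℤ) (x : Fin n → V), (∀ i, x i ∈ wt (w i)) →
    L.l n x ∈ wt (∑ i, w i + (2 - n))

namespace WeightGrading

variable {L} (G : L.WeightGrading)

/-- The part of weight `k` of the Chevalley-Eilenberg complex, where `s` has weight `-1`: it is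
spanned by the `s x_1 ⋯ s x_n` with `x_i` of weight `w_i` and `∑ (w_i - 1) = k`. -/
noncomputable def ceWeight (k : ℤ) : Submodule ℚ L.CE :=
  Submodule.span ℚ {z | ∃ (n : ℕ) (w : Fin n → ℤ) (x : Fin n → V),
    (∀ i, x i ∈ G.wt (w i)) ∧ ∑ i, (w i - 1) = k ∧ z = L.word n x}

/-- Koszulness: with the weight grading, the cochain complex `CE^0 → CE^1 → CE^2 → ⋯` is exact
in all positive weights. -/
def IsKoszul : Prop :=
  ∀ k : ℕ, ∀ z ∈ G.ceWeight (k + 1), L.ceDiff z = 0 ↔ ∃ y ∈ G.ceWeight k, L.ceDiff y = z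

/-- The graded vector space `W = V^1` of elements of weight `1`, in degree `i`. -/
abbrev weightOne (i : ℤ) : Type v := ↥(G.wt 1 ⊓ L.deg i)

/-- The canonical strict morphism from the free `L_∞`-algebra on `W = V^1` to a minimal `L`, i.e.
the unique one that extends the inclusion of `W`. -/
noncomputable def canonical (hL : L.IsMinimal) : (FreeLInfty.algebra G.weightOne).StrictHom L :=
  FreeLInfty.lift L (fun i => (G.wt 1 ⊓ L.deg i).subtype) (fun _ w => w.2.2)
    fun i w => by rw [hL]; rfl

theorem canonical_ι (hL : L.IsMinimal) (i : ℤ) (w : G.weightOne i) :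
    (G.canonical hL).toLinearMap (FreeLInfty.ι G.weightOne i w) = (w : V) :=
  FreeLInfty.lift_ι L _ _ _ i w

end WeightGrading

end chevalleyEilenberg

end LInftyAlgebra

namespace LInftyAlgebra

/-! ### Projection of the Chevalley–Eilenberg complex onto words of length one -/

section generation

variable {V : Type v} [AddCommGroup V] [Module ℚ V] (L : LInftyAlgebra V)

/-! Let `R` be any subspace that is closed under all operations and contains the part of weight `1`.
The claim is that `R` is everything; the theorem is the case where `R` is the image of the canonical
morphism.

One shows by induction on the weight that `R` contains every homogeneous part. Take `x` of weight `k
+ 2` with `k ≥ 0`. The one-letter word `s x` has weight `k + 1 > 0` in the Chevalley–Eilenberg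
complex, and it is a cycle because the differential of `L` is zero (`ceDiff_word_one`). Koszulness
gives `y` of weight `k` whose boundary is `s x`. Now compare the components of length one. On a word
`s x_1 ⋯ s x_n`, that component of the boundary is `± s l_n(x_1, …, x_n)`, so `x` is a linear
combination of values of the operations on letters of `y`.

Weights count these letters down: in a word of weight `k` the numbers `w_i - 1` are nonnegative with
sum `k`, so every letter has weight at most `k + 1`. By induction the letters lie in `R`, hence so
does `x`. This is `cogenerators_ceDiff_mem`, and `eq_top_of_wt_one_le` runs the induction. Weight
`1` is the base case: there `s x` has weight `0`, where exactness says nothing. -/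

theorem symRel_one : L.symRel 1 = ⊥ := by
  rw [symRel, Submodule.span_eq_bot]
  rintro _ ⟨a, x, σ, -, rfl⟩
  obtain rfl := Subsingleton.elim σ 1
  simp [koszulSign]

/-- The projection of the Chevalley-Eilenberg complex onto the words of length one. -/
noncomputable def cogenerators : L.CE →ₗ[ℚ] V :=
  DirectSum.toModule ℚ ℕ V fun n => if h : n = 1 then
    (L.symRel n).liftQ
      (PiTensorProduct.lift ((MultilinearMap.ofSubsingleton ℚ V V (0 : Fin 1) LinearMap.id).domDomCongr
        (finCongr h.symm)))
      -- A single letter has no nontrivial permutations, so there are no relations in length one and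
      -- the identity of `V` descends.
      (by subst h; simp [symRel_one])
    else 0

theorem cogenerators_word_one (x : Fin 1 → V) : L.cogenerators (L.word 1 x) = x 0 := by
  refine (DirectSum.toModule_lof ℚ (ι := ℕ) (M := L.SymPower) 1
    ((L.symRel 1).mkQ (PiTensorProduct.tprod ℚ x))).trans ?_
  rw [dif_pos rfl, Submodule.mkQ_apply, Submodule.liftQ_apply, PiTensorProduct.lift.tprod]
  rfl

theorem cogenerators_word_of_ne {n : ℕ} (hn : n ≠ 1) (x : Fin n → V) :
    L.cogenerators (L.word n x) = 0 := by
  refine (DirectSum.toModule_lof ℚ (ι := ℕ) (M := L.SymPower) n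
    ((L.symRel n).mkQ (PiTensorProduct.tprod ℚ x))).trans ?_
  rw [dif_neg hn, LinearMap.zero_apply]

/-- A subspace that contains the first letter of a word contains the image of the word under the
projection onto words of length one. -/
theorem cogenerators_word_mem (R : Submodule ℚ V) {k : ℕ} (x : Fin (k + 1) → V) (hx : x 0 ∈ R) :
    L.cogenerators (L.word (k + 1) x) ∈ R := by
  obtain rfl | hk := eq_or_ne k 0
  · rwa [cogenerators_word_one]
  · rw [cogenerators_word_of_ne L (by omega)]
    exact R.zero_mem

variable {L}

/-! ### The linear part of the differential, and cycles of length one -/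

/-- Each summand of the differential is a multiple of a word whose first letter is a value `l_q(…)`
on letters in `R`, so this first letter is in `R`. The projection either returns that letter (when
`q = n`) or kills the word, so neither the signs nor the coefficients matter. -/
theorem cogenerators_ceHomogeneous_mem {R : Submodule ℚ V}
    (hR : ∀ (n : ℕ) (x : Fin n → V), (∀ i, x i ∈ R) → L.l n x ∈ R)
    {n : ℕ} (a : Fin n → ℤ) (x : Fin n → V) (hx : ∀ i, x i ∈ R) :
    L.cogenerators (L.ceHomogeneous n a x) ∈ R := by
  simp only [ceHomogeneous, sum_apply, smul_apply, insertOp_apply, Units.smul_def, map_sum,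
    map_smul, map_zsmul]
  exact sum_mem fun q _ => R.smul_mem _ <| sum_mem fun σ _ => zsmul_mem
    (L.cogenerators_word_mem R _ (hR _ _ fun i => hx _)) _

/-- On a single letter only `l_0` and `l_1` contribute: the former is always zero, the latter by
minimality. The formula for the differential needs a letter of definite degree, so a general `x` is
decomposed into homogeneous components. -/
theorem ceDiff_word_one (hL : L.IsMinimal) (x : V) : L.ceDiff (L.word 1 fun _ => x) = 0 := by
  have hx : x ∈ ⨆ i, L.deg i := by
    rw [L.internal.submodule_iSup_eq_top]
    trivial
  have hadd (y z : V) : L.word 1 (fun _ => y + z) =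
      L.word 1 (fun _ => y) + L.word 1 fun _ => z := by
    have hu (u : V) : Function.update (0 : Fin 1 → V) 0 u = fun _ => u := by
      funext i
      rw [Subsingleton.elim i 0, Function.update_self]
    simpa only [hu] using (L.word 1).map_update_add 0 0 y z
  induction hx using Submodule.iSup_induction' with
  | mem i x hx =>
    have hl : L.l 1 = 0 := by
      ext y
      have := LinearMap.congr_fun hL (y 0)
      rw [d, diff_apply] at this
      refine Eq.trans (congrArg (L.l 1) ?_) this
      funext i
      rw [Subsingleton.elim i 0]
    rw [L.ceDiff_word 1 (fun _ => i) _ fun _ => hx]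
    simp only [ceHomogeneous, sum_apply, smul_apply, insertOp_apply]
    -- Both the `q = 0` and the `q = 1` summand are words whose first letter is zero.
    have h0 (m : ℕ) (t : Fin m → V) : L.word (m + 1) (Fin.cons 0 t) = 0 :=
      (L.word (m + 1)).map_coord_zero 0 rfl
    simp [Fin.sum_univ_two, L.l_zero, hl, h0]
  | zero =>
    rw [(L.word 1).map_coord_zero 0 rfl, map_zero]
  | add y z _ _ hy hz => rw [hadd, map_add, hy, hz, add_zero]

/-- This makes the image of the canonical morphism an admissible choice of `R` in
`eq_top_of_wt_one_le`. -/
theorem StrictHom.l_mem_range {V' : Type w} [AddCommGroup V'] [Module ℚ V']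
    {L' : LInftyAlgebra V'} (f : L'.StrictHom L) (n : ℕ) (x : Fin n → V)
    (hx : ∀ i, x i ∈ f.toLinearMap.range) : L.l n x ∈ f.toLinearMap.range := by
  choose y hy using hx
  exact ⟨L'.l n y, by rw [f.map_l]; simp only [hy]⟩

/-! ### Induction on the weight -/

namespace WeightGrading

variable (G : L.WeightGrading)

/-- If a subspace is closed under the operations and contains all elements of weight at most
`k + 1`, then it contains the linear part of every Chevalley-Eilenberg boundary of an element of
weight `k`. -/
theorem cogenerators_ceDiff_mem {R : Submodule ℚ V}
    (hR : ∀ (n : ℕ) (x : Fin n → V), (∀ i, x i ∈ R) → L.l n x ∈ R)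
    {k : ℤ} (hk : ∀ w ≤ k + 1, G.wt w ≤ R) {y : L.CE} (hy : y ∈ G.ceWeight k) :
    L.cogenerators (L.ceDiff y) ∈ R := by
  suffices h : G.ceWeight k ≤ R.comap (L.cogenerators ∘ₗ L.ceDiff) from h hy
  refine Submodule.span_le.2 ?_
  rintro _ ⟨n, w, x, hx, hw, rfl⟩
  -- The words spanning `ceWeight k` may carry letters labelled with any integer weight. A letter of
  -- weight `≤ 0` is zero and so is its word; only with all weights positive does the sum bound each
  -- term.
  by_cases hpos : ∀ i, 1 ≤ w i
  swap
  · push Not at hpos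
    obtain ⟨i, hi⟩ := hpos
    have h0 : x i = 0 := by simpa [G.wt_eq_bot (w i) (by omega)] using hx i
    rw [(L.word n).map_coord_zero i h0]
    exact Submodule.zero_mem _
  have hle : ∀ i, w i ≤ k + 1 := fun i => by
    have := Finset.single_le_sum (f := fun i => w i - 1)
      (fun j _ => sub_nonneg.2 (hpos j)) (Finset.mem_univ i)
    simp only [hw] at this
    omega
  -- The letters have a weight but not yet a degree, while the differential is explicit only on
  -- letters of definite degree. Passing to `V ⧸ R` turns membership into the vanishing of a
  -- multilinear map, which can be tested on bihomogeneous letters because the weight parts are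
  -- graded subspaces.
  let E := (R.mkQ ∘ₗ L.cogenerators ∘ₗ L.ceDiff).compMultilinearMap (L.word n)
  have hE : E x = 0 := by
    refine multilinear_eq_zero E (fun j => ⋃ i, (G.wt (w j) ⊓ L.deg i : Submodule ℚ V))
      (fun z hz => ?_) x fun j => ?_
    · choose a ha using fun j => Set.mem_iUnion.1 (hz j)
      change R.mkQ (L.cogenerators (L.ceDiff (L.word n z))) = 0
      rw [L.ceDiff_word n a z fun j => (ha j).2, Submodule.mkQ_apply,
        Submodule.Quotient.mk_eq_zero]
      exact cogenerators_ceHomogeneous_mem hR a z fun j => hk _ (hle j) (ha j).1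
    · rw [← Submodule.iSup_eq_span, ← G.homogeneous]
      exact hx j
  exact (Submodule.Quotient.mk_eq_zero R).1 hE

/-- A minimal Koszul `L_∞`-algebra is generated by its elements of weight `1`. -/
theorem eq_top_of_wt_one_le (hL : L.IsMinimal) (hK : G.IsKoszul) {R : Submodule ℚ V}
    (hR : ∀ (n : ℕ) (x : Fin n → V), (∀ i, x i ∈ R) → L.l n x ∈ R) (h1 : G.wt 1 ≤ R) :
    R = ⊤ := by
  -- All weights up to `n` are treated together, since the letters of the bounding element can have
  -- any weight up to `k + 1`.
  have key : ∀ (n : ℕ) (w : ℤ), w ≤ n → G.wt w ≤ R := by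
    intro n
    induction n with
    | zero =>
      intro w hw
      rw [G.wt_eq_bot w (by simpa using hw)]
      exact bot_le
    | succ n ih =>
      intro w hw x hx
      obtain hlt | rfl := hw.lt_or_eq
      · exact ih w (by push_cast at hlt; omega) hx
      obtain _ | k := n
      · exact h1 (by simpa using hx)
      -- Here `x` has weight `k + 2`, and the suspension lowers this by one.
      have hmem : L.word 1 (fun _ => x) ∈ G.ceWeight (k + 1) :=
        Submodule.subset_span ⟨1, fun _ => (k : ℤ) + 2, fun _ => x,
          fun _ => by convert hx using 2; push_cast; ring, by simp; ring, rfl⟩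
      obtain ⟨y, hy, hyx⟩ := (hK k _ hmem).1 (ceDiff_word_one hL x)
      have := G.cogenerators_ceDiff_mem hR (fun v hv => ih v (by push_cast; exact hv)) hy
      -- The linear part of the boundary of `y` is `x` itself.
      rwa [hyx, cogenerators_word_one] at this
  rw [eq_top_iff, ← G.internal.submodule_iSup_eq_top]
  exact iSup_le fun w => key w.toNat w w.self_le_toNat

/-- The generators of the free algebra are taken degree by degree, so the inclusion relies on the
part of weight `1` being the sum of its homogeneous components. -/
theorem wt_one_le_range_canonical (hL : L.IsMinimal) :
    G.wt 1 ≤ (G.canonical hL).toLinearMap.range := by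
  refine (G.homogeneous 1).trans_le ?_
  exact iSup_le fun i x hx => ⟨_, G.canonical_ι hL i ⟨x, hx⟩⟩

end WeightGrading

end generation

end LInftyAlgebra

theorem mainTheorem7 {V : Type v} [AddCommGroup V] [Module ℚ V] (L : LInftyAlgebra V)
    (hmin : L.IsMinimal) (G : L.WeightGrading) (hK : G.IsKoszul) :
    Function.Surjective (G.canonical hmin).toLinearMap :=
  LinearMap.range_eq_top.1 <| G.eq_top_of_wt_one_le hmin hK
    (G.canonical hmin).l_mem_range (G.wt_one_le_range_canonical hmin)
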